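/- Let $\mathcal M$ be a von Neumann algebra on a complex Hilbert space $\mathcal H$, let $\Omega\in\mathcal H$ be a unit vector that is cyclic for $\mathcal M$, and let $\omega(A)=\langle\Omega,A\Omega\rangle$ $(A\in\mathcal M)$. Let $V$ be a strongly continuous unitary representation of $(\mathbf R^{1+s},+)$ on $\mathcal H$ with self-adjoint generators $H$ (time translations) and $\mathbf P=(P_1,\dots,P_s)$ (space translations), i.e. $V(t,\mathbf x)=e^{i(tH+\mathbf x\mathbf P)}$, normalized so that $H\Omega=P_1\Omega=\dots=P_s\Omega=0$ (so $\omega$ is translation invariant). For a self-adjoint operator $K$ on $\mathcal H$, call $\omega$ passive with respect to $K$ if no cycle performs positive work: for every $T>0$ and every norm-continuously differentiable $h:\mathbf R\to\mathcal M$ with self-adjoint values and $h(t)=0$ for $t\notin[0,T]$, one has $$-\int_0^{T}\langle\psi(t),\dot h(t)\psi(t)\rangle\,dt\le 0,\qquad \psi(t)=e^{-itK}U_h(t)\Omega,$$ where $(U_h(t))_{t\ge0}$ is the unitary evolution solving, in the strong sense, $\frac{d}{dt}U_h(t)=-ie^{itK}h(t)e^{-itK}U_h(t)$, $U_h(0)=1$.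 Suppose that $\omega$ is passive with respect to (the closure of) $\gamma(H+\mathbf v\mathbf P)$, $\gamma=(1-|\mathbf v|^2)^{-1/2}$, for every $\mathbf v\in\mathbf R^s$ with $|\mathbf v|<1$, and that $V(x)\in\mathcal M$ for all $x\in\mathbf R^{1+s}$. Then the joint spectrum of $H$ and $\mathbf P$ (the support of their joint spectral measure) is contained in the closed forward light cone $$V_+=\{(\eta,\mathbf k)\in\mathbf R^{1+s}:\ \eta\ge0,\ \eta^2-\mathbf k^2\ge0\}.$$ -/

import Mathlib

open MeasureTheory Topology
open scoped ComplexInnerProductSpace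

noncomputable section

namespace Passivity

/-- A strongly continuous unitary representation of an additive topological group `G` on `E`. -/
structure UnitaryRep (G E : Type*) [AddGroup G] [TopologicalSpace G]
    [NormedAddCommGroup E] [InnerProductSpace ℂ E] [CompleteSpace E] where
  /-- the operators of the representation -/
  toFun : G → E →L[ℂ] E
  mem_unitary : ∀ x, toFun x ∈ unitary (E →L[ℂ] E)
  map_zero : toFun 0 = 1
  map_add : ∀ x y, toFun (x + y) = toFun x * toFun y
  continuous_apply : ∀ ξ : E, Continuous fun x => toFun x ξ

/-- A projection-valued measure on `X` with values in the orthogonal projections of `E`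
(only the values on measurable sets matter). -/
structure ProjectionValuedMeasure (X E : Type*) [MeasurableSpace X]
    [NormedAddCommGroup E] [InnerProductSpace ℂ E] [CompleteSpace E] where
  /-- the projection assigned to a set -/
  proj : Set X → E →L[ℂ] E
  isStarProjection : ∀ S, MeasurableSet S → IsStarProjection (proj S)
  proj_univ : proj Set.univ = 1
  proj_inter : ∀ S T, MeasurableSet S → MeasurableSet T → proj (S ∩ T) = proj S * proj T
  hasSum_proj : ∀ S : ℕ → Set X, (∀ n, MeasurableSet (S n)) →
    Pairwise (fun m n => Disjoint (S m) (S n)) →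
    ∀ ξ : E, HasSum (fun n => proj (S n) ξ) (proj (⋃ n, S n) ξ)

variable {E : Type*} [NormedAddCommGroup E] [InnerProductSpace ℂ E] [CompleteSpace E]

namespace UnitaryRep

/-- The self-adjoint generator `A` of a one-parameter unitary group `U t = exp (i t A)`:
`A ξ = -i (d/dt) U t ξ` at `t = 0`, defined for those `ξ` for which this derivative exists. -/
def generator (U : UnitaryRep ℝ E) : E →ₗ.[ℂ] E where
  domain :=
    { carrier := {ξ | DifferentiableAt ℝ (fun t => U.toFun t ξ) 0}
      add_mem' := fun {ξ η} hξ hη => by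
        have h : DifferentiableAt ℝ (fun t => U.toFun t ξ + U.toFun t η) 0 := hξ.add hη
        simpa only [Set.mem_ofPred_eq, ContinuousLinearMap.map_add] using h
      zero_mem' := by simp
      smul_mem' := fun c ξ hξ => by
        have h : DifferentiableAt ℝ (fun t => c • U.toFun t ξ) 0 := hξ.const_smul c
        simpa only [Set.mem_ofPred_eq, ContinuousLinearMap.map_smul] using h }
  toFun :=
    { toFun := fun ξ => -Complex.I • deriv (fun t => U.toFun t (ξ : E)) 0
      map_add' := fun ξ η => by
        have h := deriv_add (f := fun t => U.toFun t (ξ : E))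
          (g := fun t => U.toFun t (η : E)) ξ.2 η.2
        have e : (fun t => U.toFun t ((ξ + η : _) : E))
            = (fun t => U.toFun t (ξ : E)) + fun t => U.toFun t (η : E) := by
          funext t; simp
        rw [e, h, smul_add]
      map_smul' := fun c ξ => by
        have h := deriv_const_smul (f := fun t => U.toFun t (ξ : E)) c ξ.2
        have e : (fun t => U.toFun t ((c • ξ : _) : E))
            = fun t => c • U.toFun t (ξ : E) := by
          funext t; simp
        rw [e]
        erw [h]
        simp [smul_comm c Complex.I] }

/-- The one-parameter group `t ↦ V (t • a)` of the representation `V` in the direction `a`. -/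
def along {G : Type*} [AddCommGroup G] [Module ℝ G] [TopologicalSpace G] [ContinuousSMul ℝ G]
    (V : UnitaryRep G E) (a : G) : UnitaryRep ℝ E where
  toFun t := V.toFun (t • a)
  mem_unitary t := V.mem_unitary _
  map_zero := by simp [V.map_zero]
  map_add x y := by rw [add_smul, V.map_add]
  continuous_apply ξ := (V.continuous_apply ξ).comp (by fun_prop)

/-- The generator `H` of the time translations. -/
def hamiltonian {s : ℕ} (V : UnitaryRep (ℝ × EuclideanSpace ℝ (Fin s)) E) : E →ₗ.[ℂ] E :=
  (V.along (1, 0)).generator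

/-- The generator `P j` of the translations in the `j`-th spatial direction. -/
def momentum {s : ℕ} (V : UnitaryRep (ℝ × EuclideanSpace ℝ (Fin s)) E) (j : Fin s) :
    E →ₗ.[ℂ] E :=
  (V.along (0, EuclideanSpace.single j 1)).generator

/-- The self-adjoint operator `γ (H + v P)` with `γ = (1 - |v|²)^(-1/2)`: the closure of
`γ (H + ∑ j, v j P j)` on the intersection of the domains of `H` and all the `P j`. -/
def movingHamiltonian {s : ℕ} (V : UnitaryRep (ℝ × EuclideanSpace ℝ (Fin s)) E)
    (v : EuclideanSpace ℝ (Fin s)) : E →ₗ.[ℂ] E :=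
  (((1 / Real.sqrt (1 - ‖v‖ ^ 2) : ℝ) : ℂ) •
    (V.hamiltonian + ∑ j, ((v j : ℝ) : ℂ) • V.momentum j)).closure

end UnitaryRep

/-- A cycle for the algebra `M` that is switched off outside `[0, T]`: self-adjoint elements
`h t` of `M` that depend on `t` in a norm-continuously differentiable way and vanish for
`t ∉ [0, T]`. -/
structure IsCycle (M : VonNeumannAlgebra E) (T : ℝ) (h : ℝ → E →L[ℂ] E) : Prop where
  mem : ∀ t, h t ∈ M
  selfAdjoint : ∀ t, IsSelfAdjoint (h t)
  contDiff : ContDiff ℝ 1 h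
  eq_zero : ∀ t, t ∉ Set.Icc 0 T → h t = 0

/-- `W` is the perturbed unitary evolution (in the interaction picture) of the cycle `h` with
respect to the free dynamics `U t = exp (i t K)`:
`W 0 = 1` and `(d/dt) W t = -i U(t) h(t) U(-t) W(t)` for `t ≥ 0`, in the strong sense. -/
structure IsPerturbedEvolution (U : UnitaryRep ℝ E) (h W : ℝ → E →L[ℂ] E) : Prop where
  mem_unitary : ∀ t, 0 ≤ t → W t ∈ unitary (E →L[ℂ] E)
  initial : W 0 = 1
  hasDeriv : ∀ ξ : E, ∀ t, 0 ≤ t →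
    HasDerivWithinAt (fun r => W r ξ)
      (-Complex.I • U.toFun t (h t (U.toFun (-t) (W t ξ)))) (Set.Ici 0) t

/-- The work `∫₀ᵀ ⟨ψ t, h' t ψ t⟩ dt` required for a cycle, where `ψ t = U(-t) W(t) Ω`.
For a cycle the integrand is real and continuous, and the integral does not depend on the choice
of `T` as long as `h` vanishes outside `[0, T]`. -/
def work (U : UnitaryRep ℝ E) (Ω : E) (T : ℝ) (h W : ℝ → E →L[ℂ] E) : ℝ :=
  ∫ t in (0 : ℝ)..T, (⟪U.toFun (-t) (W t Ω), deriv h t (U.toFun (-t) (W t Ω))⟫).re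

/-- The state `A ↦ ⟨Ω, A Ω⟩` of `M` is passive with respect to the Hamiltonian `K`: with the
dynamics `U t = exp (i t K)` (the unitary group generated by `K`), no cycle performs positive
work. -/
def IsPassive (M : VonNeumannAlgebra E) (Ω : E) (K : E →ₗ.[ℂ] E) : Prop :=
  ∀ U : UnitaryRep ℝ E, U.generator = K →
    ∀ (T : ℝ) (h W : ℝ → E →L[ℂ] E), 0 < T → IsCycle M T h → IsPerturbedEvolution U h W →
      -work U Ω T h W ≤ 0

namespace ProjectionValuedMeasure

variable {X : Type*} [MeasurableSpace X]

lemma proj_empty (F : ProjectionValuedMeasure X E) : F.proj ∅ = 0 := by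
  ext ξ
  have h := F.hasSum_proj (fun _ => ∅) (fun _ => MeasurableSet.empty)
    (fun _ _ _ => disjoint_bot_left) ξ
  simpa using tendsto_nhds_unique tendsto_const_nhds h.summable.tendsto_atTop_zero

lemma re_inner_nonneg (F : ProjectionValuedMeasure X E) (ξ : E) {S : Set X}
    (hS : MeasurableSet S) : 0 ≤ (⟪ξ, F.proj S ξ⟫).re := by
  have hp := F.isStarProjection S hS
  have e : ⟪ξ, F.proj S ξ⟫ = ⟪F.proj S ξ, F.proj S ξ⟫ := by
    rw [← ContinuousLinearMap.adjoint_inner_right, ← ContinuousLinearMap.star_eq_adjoint,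
      hp.isSelfAdjoint.star_eq, ← mul_apply_eq_comp, hp.isIdempotentElem.eq]
  rw [e]
  exact inner_self_nonneg (𝕜 := ℂ)

/-- The finite measure `S ↦ ⟨ξ, F(S) ξ⟩`. -/
def scalarMeasure (F : ProjectionValuedMeasure X E) (ξ : E) : Measure X :=
  Measure.ofMeasurable (fun S _ => ENNReal.ofReal (⟪ξ, F.proj S ξ⟫).re)
    (by simp [F.proj_empty])
    (fun S hS hd => by
      have h1 := F.hasSum_proj S hS hd ξ
      have h2 : HasSum (fun n => (⟪ξ, F.proj (S n) ξ⟫).re) (⟪ξ, F.proj (⋃ n, S n) ξ⟫).re :=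
        ((Complex.reCLM.comp ((innerSL ℂ ξ).restrictScalars ℝ)).hasSum h1)
      rw [← h2.tsum_eq]
      exact ENNReal.ofReal_tsum_of_nonneg (fun n => F.re_inner_nonneg ξ (hS n)) h2.summable)

/-- `A = ∫ f dF`: the domain of `A` consists of the `ξ` with `∫ f² d⟨ξ, F ξ⟩ < ∞`, and
`⟨ξ, A ξ⟩ = ∫ f d⟨ξ, F ξ⟩` for these `ξ`. -/
def Represents (F : ProjectionValuedMeasure X E) (f : X → ℝ) (A : E →ₗ.[ℂ] E) : Prop :=
  (∀ ξ, ξ ∈ A.domain ↔ Integrable (fun p => f p ^ 2) (F.scalarMeasure ξ)) ∧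
  ∀ ξ : A.domain, ⟪(ξ : E), A ξ⟫ = ((∫ p, f p ∂F.scalarMeasure (ξ : E) : ℝ) : ℂ)

/-- The support of a projection-valued measure. -/
def support [TopologicalSpace X] (F : ProjectionValuedMeasure X E) : Set X :=
  {p | ∀ S, IsOpen S → p ∈ S → F.proj S ≠ 0}

end ProjectionValuedMeasure

/-- `F` is the joint spectral measure (the product of the spectral measures) of the strongly
commuting self-adjoint operators `H, P 1, …, P s`: it is a projection-valued measure on
`ℝ × ℝˢ` whose marginals are the spectral measures of `H` and of the `P j`. -/
structure IsJointSpectralMeasure {s : ℕ} (H : E →ₗ.[ℂ] E) (P : Fin s → E →ₗ.[ℂ] E)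
    (F : ProjectionValuedMeasure (ℝ × EuclideanSpace ℝ (Fin s)) E) : Prop where
  energy : F.Represents (fun p => p.1) H
  momentum : ∀ j, F.Represents (fun p => p.2 j) (P j)

/-- The joint spectrum of strongly commuting self-adjoint operators `H, P 1, …, P s`: the support
of their joint spectral measure, which exists and is unique by the spectral theorem. -/
def jointSpectrum {s : ℕ} (H : E →ₗ.[ℂ] E) (P : Fin s → E →ₗ.[ℂ] E) :
    Set (ℝ × EuclideanSpace ℝ (Fin s)) :=
  {p | ∃ F : ProjectionValuedMeasure (ℝ × EuclideanSpace ℝ (Fin s)) E,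
    IsJointSpectralMeasure H P F ∧ p ∈ F.support}

/-- The closed forward light cone. -/
def forwardCone (s : ℕ) : Set (ℝ × EuclideanSpace ℝ (Fin s)) :=
  {p | 0 ≤ p.1 ∧ 0 ≤ p.1 ^ 2 - ‖p.2‖ ^ 2}

/-- `Ω` is a cyclic vector of `M`. -/
def IsCyclic (M : VonNeumannAlgebra E) (Ω : E) : Prop :=
  Dense {ξ : E | ∃ A ∈ M, A Ω = ξ}

end Passivity

end

open Passivity

/-!
The dynamics `U(t) = V(tγ(1, v))` of an observer with velocity `v` has the generator
`K = γ(H + v P)`. Choose `B = B*` in `M` with `t ↦ U(-t) B U(t)` continuously differentiable in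
norm, and let `δ` be the derivative of this function at `0`. In the interaction picture, the cycle
`φ'(t) U(-t) B U(t)` becomes the perturbation `φ'(t) B`, whose evolution operators
`exp (-i φ(t) B)` are explicit. The work that it performs depends only on the final value `c` of
`φ`; up to sign it is the integral over `0 ≤ r ≤ c` of `⟨exp (-irB) Ω, δ exp (-irB) Ω⟩`. Passivity
for all real `c` says that this integral is minimal at `c = 0`, and the second derivative there
gives `Im ⟨B Ω, δ Ω⟩ ≤ 0`.

If `B = A + A*` with `A* Ω = 0`, then this inequality reads `⟨A Ω, K A Ω⟩ ≥ 0`. Since the `U(t)`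
belong to `M`, the operators `A = (1 - U(t)) R C R` are available, where `C` is any element of `M`
and `R` is an average of the `U(r)` against a bump function. Cyclicity of `Ω` and approximation
then give `⟨(1 - U(t)) ξ, K (1 - U(t)) ξ⟩ ≥ 0` for all `ξ` in the domain of `K`. In the mean over
`t` the cross terms disappear, so that `K ≥ 0`.

Finally, a point `p` of the joint spectrum outside the forward cone satisfies
`p.1 + ⟨v, p.2⟩ < 0` for some `|v| < 1`. Vectors whose spectral measure is concentrated near `p`
then contradict `K ≥ 0` for this `v`.
-/

namespace Passivity

open Filter
open scoped ContDiff Convolution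

/-! ### Calculus -/

section RestrictScalars

variable {𝕜 𝕜' F G : Type*} [NontriviallyNormedField 𝕜] [NontriviallyNormedField 𝕜']
  [NormedAlgebra 𝕜 𝕜'] [NormedAddCommGroup F] [NormedSpace 𝕜' F]
  [NormedAddCommGroup G] [NormedSpace 𝕜 G] [NormedSpace 𝕜' G] [IsScalarTower 𝕜 𝕜' G]

lemma hasDerivAt_clm_comp [NormedSpace 𝕜 F] [IsScalarTower 𝕜 𝕜' F] (A : F →L[𝕜'] G) {f : 𝕜 → F}
    {f' : F} {t : 𝕜} (h : HasDerivAt f f' t) : HasDerivAt (fun r => A (f r)) (A f') t :=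
  (A.restrictScalars 𝕜).hasFDerivAt.comp_hasDerivAt t h

lemma hasDerivAt_clm_apply {L : 𝕜 → F →L[𝕜'] G} {L' : F →L[𝕜'] G} {t : 𝕜} (h : HasDerivAt L L' t)
    (ξ : F) : HasDerivAt (fun r => L r ξ) (L' ξ) t :=
  hasDerivAt_clm_comp (ContinuousLinearMap.apply 𝕜' G ξ) h

end RestrictScalars

lemma hasDerivAt_of_forall_hasDerivAt_apply {𝕜 F G : Type*} [RCLike 𝕜] [NormedAddCommGroup F]
    [NormedSpace 𝕜 F] [NormedAddCommGroup G] [NormedSpace ℝ G] [NormedSpace 𝕜 G] [CompleteSpace G]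
    {L L' : ℝ → F →L[𝕜] G} (hL' : Continuous L')
    (h : ∀ ξ t, HasDerivAt (fun r => L r ξ) (L' t ξ) t) (t : ℝ) : HasDerivAt L (L' t) t := by
  have hL : L = fun t => L 0 + ∫ r in (0 : ℝ)..t, L' r := by
    funext t
    ext ξ
    rw [add_apply, ContinuousLinearMap.intervalIntegral_apply (hL'.intervalIntegrable 0 t),
      intervalIntegral.integral_eq_sub_of_hasDerivAt (fun r _ => h ξ r)
        ((hL'.clm_apply continuous_const).intervalIntegrable 0 t), add_sub_cancel]
  rw [hL]
  exact (hL'.integral_hasStrictDerivAt 0 t).hasDerivAt.const_add _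

lemma deriv_deriv_nonneg_of_isLocalMin {f : ℝ → ℝ} {a : ℝ} (h : IsLocalMin f a)
    (hc : ContinuousAt f a) : 0 ≤ deriv (deriv f) a := by
  by_contra! hneg
  have hmax : IsLocalMax f a := isLocalMax_of_deriv_deriv_neg hneg h.deriv_eq_zero hc
  have hconst : f =ᶠ[𝓝 a] fun _ => f a := by
    filter_upwards [h, hmax] with x hmin hmax using le_antisymm hmax hmin
  have hzero : deriv (deriv f) a = 0 := by
    rw [hconst.deriv.deriv_eq]
    simp
  exact hneg.ne hzero

lemma nonneg_of_forall_integral_nonneg {g : ℝ → ℝ} {m a : ℝ} (hg : Continuous g)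
    (hm : HasDerivAt g m a) (h : ∀ c, 0 ≤ ∫ r in a..c, g r) : 0 ≤ m := by
  have hderiv : ∀ c, HasDerivAt (fun c => ∫ r in a..c, g r) (g c) c := fun c =>
    (hg.integral_hasStrictDerivAt a c).hasDerivAt
  have hmin : IsLocalMin (fun c => ∫ r in a..c, g r) a :=
    Eventually.of_forall fun c => by simpa using h c
  have hsecond := deriv_deriv_nonneg_of_isLocalMin hmin (hderiv a).continuousAt
  rwa [funext fun c => (hderiv c).deriv, hm.deriv] at hsecond

lemma nonneg_of_abs_le_of_deriv_le {f : ℝ → ℝ} {C m : ℝ} (hf : Differentiable ℝ f)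
    (hC : ∀ t, |f t| ≤ C) (hm : ∀ t, deriv f t ≤ m) : 0 ≤ m := by
  by_contra! hneg
  have hC0 : 0 ≤ C := (abs_nonneg _).trans (hC 0)
  have ht : 0 ≤ (2 * C + 1) / -m := div_nonneg (by positivity) (by linarith)
  have hdrop := image_sub_le_mul_sub_of_deriv_le hf hm ht
  have hlower := neg_le_of_abs_le (hC ((2 * C + 1) / -m))
  have hupper := le_of_abs_le (hC 0)
  have hmul : m * ((2 * C + 1) / -m) = -(2 * C + 1) := by field_simp [hneg.ne]
  linarith

/-! ### Partially defined operators -/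

section Graph

variable {R F G ι : Type*} [Ring R] [AddCommGroup F] [Module R F] [AddCommGroup G] [Module R G]

lemma mem_graph_add_iff {S T : F →ₗ.[R] G} {x : F} {y : G} :
    (x, y) ∈ (S + T).graph ↔ ∃ u v, (x, u) ∈ S.graph ∧ (x, v) ∈ T.graph ∧ u + v = y := by
  simp only [LinearPMap.mem_graph_iff]
  constructor
  · rintro ⟨x, rfl, rfl⟩
    exact ⟨_, _, ⟨⟨x, x.2.1⟩, rfl, rfl⟩, ⟨⟨x, x.2.2⟩, rfl, rfl⟩, (LinearPMap.add_apply S T x).symm⟩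
  · rintro ⟨_, _, ⟨x, rfl, rfl⟩, ⟨⟨_, hx⟩, rfl, rfl⟩, rfl⟩
    exact ⟨⟨x, x.2, hx⟩, rfl, LinearPMap.add_apply S T _⟩

lemma mem_graph_smul_iff {M : Type*} [Monoid M] [DistribMulAction M G] [SMulCommClass R M G]
    {c : M} {T : F →ₗ.[R] G} {x : F} {y : G} :
    (x, y) ∈ (c • T).graph ↔ ∃ u, (x, u) ∈ T.graph ∧ c • u = y := by
  simp only [LinearPMap.mem_graph_iff]
  constructor
  · rintro ⟨x, rfl, rfl⟩
    exact ⟨T x, ⟨x, rfl, rfl⟩, (LinearPMap.smul_apply c T x).symm⟩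
  · rintro ⟨_, ⟨x, rfl, rfl⟩, rfl⟩
    exact ⟨x, rfl, LinearPMap.smul_apply c T x⟩

lemma mem_graph_sum_iff (S : Finset ι) {T : ι → F →ₗ.[R] G} {x : F} {y : G} :
    (x, y) ∈ (∑ i ∈ S, T i).graph ↔
      ∃ u : ι → G, (∀ i ∈ S, (x, u i) ∈ (T i).graph) ∧ ∑ i ∈ S, u i = y := by
  classical
  induction S using Finset.induction_on generalizing y with
  | empty =>
    simp only [Finset.sum_empty, LinearPMap.mem_graph_iff]
    constructor
    · rintro ⟨_, -, hy⟩
      exact ⟨0, by simp, hy⟩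
    · rintro ⟨-, -, hy⟩
      exact ⟨⟨x, trivial⟩, rfl, hy⟩
  | insert i S hi ih =>
    simp only [Finset.sum_insert hi, mem_graph_add_iff, ih]
    constructor
    · rintro ⟨v, _, hv, ⟨u, hu, rfl⟩, rfl⟩
      have hne : ∀ j ∈ S, j ≠ i := fun j hj => ne_of_mem_of_not_mem hj hi
      refine ⟨Function.update u i v, fun j hj => ?_, ?_⟩
      · obtain rfl | hj := Finset.mem_insert.1 hj
        · simpa using hv
        · simpa [hne j hj] using hu j hj
      · rw [Function.update_self, Finset.sum_congr rfl fun j hj => by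
          rw [Function.update_of_ne (hne j hj)]]
    · rintro ⟨u, hu, hy⟩
      exact ⟨u i, _, hu i (Finset.mem_insert_self i S),
        ⟨u, fun j hj => hu j (Finset.mem_insert_of_mem hj), rfl⟩, hy⟩

end Graph

lemma exists_clm_mem_graph {𝕜 F G H : Type*} [NontriviallyNormedField 𝕜]
    [NormedAddCommGroup F] [NormedSpace 𝕜 F]
    [NormedAddCommGroup G] [NormedSpace 𝕜 G] [CompleteSpace G]
    [NormedAddCommGroup H] [NormedSpace 𝕜 H] [CompleteSpace H]
    {T : F →ₗ.[𝕜] G} (hT : T.IsClosed) {R : H →L[𝕜] F} (hR : ∀ ξ, R ξ ∈ T.domain) :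
    ∃ D : H →L[𝕜] G, ∀ ξ, (R ξ, D ξ) ∈ T.graph := by
  let D : H →ₗ[𝕜] G := T.toFun ∘ₗ (R : H →ₗ[𝕜] F).codRestrict T.domain hR
  have hD : ∀ ξ, (R ξ, D ξ) ∈ T.graph := fun ξ => T.mem_graph ⟨R ξ, hR ξ⟩
  refine ⟨.ofSeqClosedGraph (g := D) fun u ξ x hu hDu => ?_, hD⟩
  have hlim := ((R.continuous.tendsto ξ).comp hu).prodMk_nhds hDu
  have hmem : (R ξ, x) ∈ T.graph :=
    hT.mem_of_tendsto hlim (Eventually.of_forall fun n => hD (u n))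
  exact T.mem_graph_snd_inj hmem (hD ξ) rfl

/-! ### The light cone -/

section LightCone

/-- The Lorentz factor `γ = (1 - |v|²)^(-1/2)` of a velocity `v`, with junk value `0` for
`|v| ≥ 1`. -/
noncomputable def lorentzFactor {F : Type*} [Norm F] (v : F) : ℝ :=
  1 / Real.sqrt (1 - ‖v‖ ^ 2)

lemma lorentzFactor_pos {F : Type*} [SeminormedAddGroup F] {v : F} (hv : ‖v‖ < 1) :
    0 < lorentzFactor v :=
  one_div_pos.2 (Real.sqrt_pos.2 (sub_pos.2 (pow_lt_one₀ (norm_nonneg v) hv two_ne_zero)))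

/-- The four-velocity `γ (1, v)`: the direction of the time axis of an observer with
velocity `v`. -/
noncomputable def fourVelocity {F : Type*} [NormedAddCommGroup F] [NormedSpace ℝ F] (v : F) :
    ℝ × F :=
  lorentzFactor v • (1, v)

lemma mem_forwardCone_iff {s : ℕ} {p : ℝ × EuclideanSpace ℝ (Fin s)} :
    p ∈ forwardCone s ↔ ‖p.2‖ ≤ p.1 := by
  change 0 ≤ p.1 ∧ 0 ≤ p.1 ^ 2 - ‖p.2‖ ^ 2 ↔ ‖p.2‖ ≤ p.1
  rw [sub_nonneg]
  exact ⟨fun ⟨h, hsq⟩ => le_of_sq_le_sq hsq h, fun h => ⟨(norm_nonneg _).trans h, by gcongr⟩⟩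

variable {F : Type*} [NormedAddCommGroup F] [InnerProductSpace ℝ F] {η : ℝ} {k : F}

lemma exists_norm_lt_one_add_inner_neg (h : η < ‖k‖) :
    ∃ v : F, ‖v‖ < 1 ∧ η + inner ℝ v k < 0 := by
  rcases eq_or_ne k 0 with rfl | hk
  · exact ⟨0, by simp, by simpa using h⟩
  have hk : 0 < ‖k‖ := norm_pos_iff.2 hk
  obtain ⟨m, hm, hmk⟩ := exists_between (max_lt h hk)
  obtain ⟨hηm, hm0⟩ := max_lt_iff.1 hm
  refine ⟨-(m / ‖k‖ ^ 2) • k, ?_, ?_⟩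
  · calc ‖-(m / ‖k‖ ^ 2) • k‖ = m / ‖k‖ := by
          rw [norm_smul, norm_neg, Real.norm_of_nonneg (by positivity)]
          field_simp
      _ < 1 := (div_lt_one hk).2 hmk
  · rw [real_inner_smul_left, real_inner_self_eq_norm_sq, neg_mul,
      div_mul_cancel₀ _ (pow_ne_zero 2 hk.ne')]
    linarith

lemma exists_fourVelocity_pairing_neg (h : η < ‖k‖) :
    ∃ v : F, ‖v‖ < 1 ∧ (fourVelocity v).1 * η + inner ℝ (fourVelocity v).2 k < 0 := by
  obtain ⟨v, hv, hneg⟩ := exists_norm_lt_one_add_inner_neg h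
  refine ⟨v, hv, ?_⟩
  rw [fourVelocity, Prod.smul_fst, Prod.smul_snd, smul_eq_mul, mul_one, real_inner_smul_left,
    ← mul_add]
  exact mul_neg_of_pos_of_neg (lorentzFactor_pos hv) hneg

end LightCone

variable {E : Type*} [NormedAddCommGroup E] [InnerProductSpace ℂ E] [CompleteSpace E]

namespace UnitaryRep

/-! ### Unitary representations and generators -/

section Group

variable {G : Type*} [AddGroup G] [TopologicalSpace G] (V : UnitaryRep G E)

@[simp]
lemma norm_apply (x : G) (ξ : E) : ‖V.toFun x ξ‖ = ‖ξ‖ :=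
  ContinuousLinearMap.norm_map_of_mem_unitary (V.mem_unitary x) ξ

@[simp]
lemma inner_apply_apply (x : G) (ξ η : E) : ⟪V.toFun x ξ, V.toFun x η⟫ = ⟪ξ, η⟫ :=
  ContinuousLinearMap.inner_map_map_of_mem_unitary (V.mem_unitary x) ξ η

lemma add_apply (x y : G) (ξ : E) : V.toFun (x + y) ξ = V.toFun x (V.toFun y ξ) := by
  rw [V.map_add, mul_apply_eq_comp]

lemma toFun_mul_toFun_neg (x : G) : V.toFun x * V.toFun (-x) = 1 := by
  rw [← V.map_add, add_neg_cancel, V.map_zero]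

@[simp]
lemma apply_neg_apply (x : G) (ξ : E) : V.toFun x (V.toFun (-x) ξ) = ξ :=
  DFunLike.congr_fun (V.toFun_mul_toFun_neg x) ξ

lemma star_toFun (x : G) : star (V.toFun x) = V.toFun (-x) :=
  left_inv_eq_right_inv (Unitary.star_mul_self_of_mem (V.mem_unitary x)) (V.toFun_mul_toFun_neg x)

lemma continuous_uncurry : Continuous fun p : G × E => V.toFun p.1 p.2 :=
  continuous_prod_of_continuous_lipschitzWith' _ 1
    (fun x => (AddMonoidHomClass.isometry_of_norm (V.toFun x) (V.norm_apply x)).lipschitz)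
    V.continuous_apply

end Group

lemma commute {G : Type*} [AddCommGroup G] [TopologicalSpace G] (V : UnitaryRep G E) (x y : G) :
    Commute (V.toFun x) (V.toFun y) := by
  rw [commute_iff_eq, ← V.map_add, ← V.map_add, add_comm]

section Generator

variable {U : UnitaryRep ℝ E} {ξ η x y : E} {R : E →L[ℂ] E}

lemma mem_generator_graph_iff :
    (ξ, x) ∈ U.generator.graph ↔ HasDerivAt (fun t => U.toFun t ξ) (Complex.I • x) 0 := by
  rw [LinearPMap.mem_graph_iff]
  constructor
  · rintro ⟨ξ, rfl, rfl⟩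
    have hξ : DifferentiableAt ℝ (fun t => U.toFun t (ξ : E)) 0 := ξ.2
    refine hξ.hasDerivAt.congr_deriv ?_
    change _ = Complex.I • -Complex.I • deriv (fun t => U.toFun t (ξ : E)) 0
    simp [smul_smul]
  · intro h
    refine ⟨⟨ξ, h.differentiableAt⟩, rfl, ?_⟩
    change -Complex.I • deriv (fun t => U.toFun t ξ) 0 = x
    simp [h.deriv, smul_smul]

lemma hasDerivAt_apply (h : (ξ, x) ∈ U.generator.graph) (t : ℝ) :
    HasDerivAt (fun r => U.toFun r ξ) (U.toFun t (Complex.I • x)) t := by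
  have hshift : HasDerivAt (fun r => U.toFun (r - t) ξ) (Complex.I • x) t :=
    HasDerivAt.comp_sub_const t t (by simpa using mem_generator_graph_iff.1 h)
  refine (hasDerivAt_clm_comp (U.toFun t) hshift).congr_of_eventuallyEq
    (Eventually.of_forall fun r => ?_)
  change U.toFun r ξ = U.toFun t (U.toFun (r - t) ξ)
  rw [← U.add_apply, add_sub_cancel]

lemma map_mem_generator_graph (hR : ∀ t, Commute R (U.toFun t))
    (h : (ξ, x) ∈ U.generator.graph) : (R ξ, R x) ∈ U.generator.graph := by
  rw [mem_generator_graph_iff, ← map_smul]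
  refine (hasDerivAt_clm_comp R (mem_generator_graph_iff.1 h)).congr_of_eventuallyEq
    (Eventually.of_forall fun t => ?_)
  exact (DFunLike.congr_fun (hR t).eq ξ).symm

lemma inner_eq_inner_of_mem_generator_graph (hξ : (ξ, x) ∈ U.generator.graph)
    (hη : (η, y) ∈ U.generator.graph) : ⟪x, η⟫ = ⟪ξ, y⟫ := by
  have hconst : HasDerivAt (fun t => ⟪U.toFun t ξ, U.toFun t η⟫) 0 0 := by
    simpa only [U.inner_apply_apply] using hasDerivAt_const (0 : ℝ) ⟪ξ, η⟫
  have hderiv := ((mem_generator_graph_iff.1 hξ).inner ℂ (mem_generator_graph_iff.1 hη)).unique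
    hconst
  simp only [U.map_zero, one_apply_eq_self, inner_smul_left, inner_smul_right, Complex.conj_I,
    neg_mul, ← sub_eq_add_neg, sub_eq_zero] at hderiv
  exact (mul_left_cancel₀ Complex.I_ne_zero hderiv).symm

lemma apply_eq_of_mem_generator_graph (h : (ξ, (0 : E)) ∈ U.generator.graph) (t : ℝ) :
    U.toFun t ξ = ξ := by
  have hderiv : ∀ r, HasDerivAt (fun r => U.toFun r ξ) 0 r := fun r => by
    simpa using hasDerivAt_apply h r
  simpa [U.map_zero] using is_const_of_deriv_eq_zero (fun r => (hderiv r).differentiableAt)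
    (fun r => (hderiv r).deriv) t 0

lemma mem_generator_graph_iff_forall_integral :
    (ξ, x) ∈ U.generator.graph ↔
      ∀ t, U.toFun t ξ - ξ = ∫ r in (0 : ℝ)..t, U.toFun r (Complex.I • x) := by
  have hcont := U.continuous_apply (Complex.I • x)
  constructor
  · intro h t
    rw [intervalIntegral.integral_eq_sub_of_hasDerivAt (fun r _ => hasDerivAt_apply h r)
      (hcont.intervalIntegrable 0 t), U.map_zero, one_apply_eq_self]
  · intro h
    rw [mem_generator_graph_iff]
    have hderiv := (hcont.integral_hasStrictDerivAt 0 0).hasDerivAt.const_add ξ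
    rw [U.map_zero, one_apply_eq_self] at hderiv
    refine hderiv.congr_of_eventuallyEq (Eventually.of_forall fun r => ?_)
    change U.toFun r ξ = ξ + ∫ q in (0 : ℝ)..r, U.toFun q (Complex.I • x)
    rw [← h r, add_sub_cancel]

variable (U) in
lemma isClosed_generator : U.generator.IsClosed := by
  have hgraph : (U.generator.graph : Set (E × E)) = ⋂ t : ℝ, {p : E × E |
      U.toFun t p.1 - p.1 = ∫ r in (0 : ℝ)..t, U.toFun r (Complex.I • p.2)} := by
    ext p
    simp only [SetLike.mem_coe, Set.mem_iInter]
    exact mem_generator_graph_iff_forall_integral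
  change IsClosed (U.generator.graph : Set (E × E))
  rw [hgraph]
  refine isClosed_iInter fun t => isClosed_eq (by fun_prop) ?_
  refine intervalIntegral.continuous_parametric_intervalIntegral_of_continuous' ?_ 0 t
  exact U.continuous_uncurry.comp
    (continuous_snd.prodMk (continuous_const.smul (continuous_snd.comp continuous_fst)))

lemma continuous_mul_of_forall_mem_domain (hR : ∀ ξ, R ξ ∈ U.generator.domain) :
    Continuous fun t => U.toFun t * R := by
  obtain ⟨D, hD⟩ := exists_clm_mem_graph U.isClosed_generator hR
  refine LipschitzWith.continuous (K := ‖D‖₊) (LipschitzWith.of_dist_le_mul fun r t => ?_)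
  rw [dist_eq_norm, dist_eq_norm, coe_nnnorm]
  refine ContinuousLinearMap.opNorm_le_bound _ (by positivity) fun ξ => ?_
  have hbound : ‖U.toFun r (R ξ) - U.toFun t (R ξ)‖ ≤ ‖D‖ * ‖ξ‖ * ‖r - t‖ :=
    convex_univ.norm_image_sub_le_of_norm_hasDerivWithin_le
      (fun q _ => (hasDerivAt_apply (hD ξ) q).hasDerivWithinAt)
      (fun q _ => by simpa [norm_smul] using D.le_opNorm ξ) (Set.mem_univ t) (Set.mem_univ r)
  calc ‖(U.toFun r * R - U.toFun t * R) ξ‖ ≤ ‖D‖ * ‖ξ‖ * ‖r - t‖ := hbound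
    _ = ‖D‖ * ‖r - t‖ * ‖ξ‖ := by ring

-- The loss of one derivative is genuine: strong differentiability only gives a norm-Lipschitz map.
lemma contDiff_one_mul_of_forall_contDiff_two
    (hR : ∀ ξ, ContDiff ℝ 2 fun t => U.toFun t (R ξ)) : ContDiff ℝ 1 fun t => U.toFun t * R := by
  obtain ⟨D, hD⟩ := exists_clm_mem_graph U.isClosed_generator
    fun ξ => (hR ξ).differentiable two_ne_zero 0
  have hderiv : ∀ ξ t, HasDerivAt (fun t => U.toFun t (R ξ))
      ((U.toFun t * (Complex.I • D)) ξ) t := fun ξ => hasDerivAt_apply (hD ξ)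
  have hID : ∀ ξ, (Complex.I • D) ξ ∈ U.generator.domain := fun ξ => by
    have hsecond := ((contDiff_succ_iff_deriv (n := 1)).1 (hR ξ)).2.2.differentiable one_ne_zero
    rw [funext fun t => (hderiv ξ t).deriv] at hsecond
    exact hsecond 0
  have hcont := continuous_mul_of_forall_mem_domain hID
  have hnorm : ∀ t, HasDerivAt (fun t => U.toFun t * R) (U.toFun t * (Complex.I • D)) t :=
    hasDerivAt_of_forall_hasDerivAt_apply hcont hderiv
  rw [contDiff_one_iff_deriv, funext fun t => (hnorm t).deriv]
  exact ⟨fun t => (hnorm t).differentiableAt, hcont⟩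

-- The averages of `t ↦ ⟪ξ, U t x⟫`, the derivative of the bounded function `-i ⟪ξ, U t ξ⟫`, tend
-- to zero, so that the cross terms of the hypothesis disappear in the mean.
lemma re_inner_nonneg_of_forall_sub_apply (h : (ξ, x) ∈ U.generator.graph)
    (hnonneg : ∀ t, 0 ≤ (⟪ξ - U.toFun t ξ, x - U.toFun t x⟫).re) : 0 ≤ (⟪ξ, x⟫).re := by
  have hderiv : ∀ t, HasDerivAt (fun t => (⟪ξ, U.toFun t ξ⟫).im) (⟪ξ, U.toFun t x⟫).re t :=
    fun t => by
      have := hasDerivAt_clm_comp Complex.imCLM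
        (hasDerivAt_clm_comp (innerSL ℂ ξ) (hasDerivAt_apply h t))
      simpa [inner_smul_right] using this
  have hle : ∀ t, (⟪ξ, U.toFun t x⟫).re ≤ (⟪ξ, x⟫).re := fun t => by
    have hsymm : (⟪U.toFun t ξ, x⟫).re = (⟪ξ, U.toFun t x⟫).re := by
      rw [← inner_eq_inner_of_mem_generator_graph
        (map_mem_generator_graph (fun r => U.commute t r) h) h, ← inner_conj_symm, Complex.conj_re]
    have hexpand := hnonneg t
    simp only [inner_sub_left, inner_sub_right, U.inner_apply_apply, Complex.sub_re, hsymm]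
      at hexpand
    linarith
  refine nonneg_of_abs_le_of_deriv_le (C := ‖ξ‖ * ‖ξ‖) (fun t => (hderiv t).differentiableAt)
    (fun t => ?_) fun t => (hderiv t).deriv.trans_le (hle t)
  calc |(⟪ξ, U.toFun t ξ⟫).im| ≤ ‖⟪ξ, U.toFun t ξ⟫‖ := Complex.abs_im_le_norm _
    _ ≤ ‖ξ‖ * ‖U.toFun t ξ‖ := norm_inner_le_norm _ _
    _ = ‖ξ‖ * ‖ξ‖ := by rw [U.norm_apply]

end Generator

/-! ### Mollifiers -/

section Smear

variable {G : Type*} [AddGroup G] [TopologicalSpace G] [ContinuousNeg G]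
  [SecondCountableTopology G] [MeasurableSpace G] [BorelSpace G] {μ : Measure G}
  (V : UnitaryRep G E) {φ : G → ℝ}

lemma integrable_smul_apply (hφ : Integrable φ μ) (ξ : E) :
    Integrable (fun x => φ x • V.toFun (-x) ξ) μ :=
  hφ.smul_bdd ‖ξ‖ ((V.continuous_apply ξ).comp continuous_neg).aestronglyMeasurable
    (Eventually.of_forall fun x => (V.norm_apply (-x) ξ).le)

/-- The smeared operator `∫ φ(x) V(-x) dμ(x)`. The sign makes `x ↦ V(x) (V.smear hφ ξ)` the
convolution of `φ` with `x ↦ V(x) ξ`. -/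
noncomputable def smear (hφ : Integrable φ μ) : E →L[ℂ] E :=
  LinearMap.mkContinuous
    { toFun := fun ξ => ∫ x, φ x • V.toFun (-x) ξ ∂μ
      map_add' := fun ξ η => by
        rw [← integral_add (V.integrable_smul_apply hφ ξ) (V.integrable_smul_apply hφ η)]
        simp only [ContinuousLinearMap.map_add, smul_add]
      map_smul' := fun c ξ => by
        rw [RingHom.id_apply, ← integral_smul]
        simp only [map_smul, smul_comm c] }
    (∫ x, ‖φ x‖ ∂μ) fun ξ => by
      calc ‖∫ x, φ x • V.toFun (-x) ξ ∂μ‖ ≤ ∫ x, ‖φ x • V.toFun (-x) ξ‖ ∂μ :=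
            norm_integral_le_integral_norm _
        _ = (∫ x, ‖φ x‖ ∂μ) * ‖ξ‖ := by
            simp_rw [norm_smul, V.norm_apply]
            exact integral_mul_const _ _

lemma smear_apply (hφ : Integrable φ μ) (ξ : E) :
    V.smear hφ ξ = ∫ x, φ x • V.toFun (-x) ξ ∂μ := rfl

lemma map_smear_apply {F : Type*} [NormedAddCommGroup F] [NormedSpace ℂ F] [CompleteSpace F]
    (A : E →L[ℂ] F) (hφ : Integrable φ μ) (ξ : E) :
    A (V.smear hφ ξ) = ∫ x, φ x • A (V.toFun (-x) ξ) ∂μ := by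
  rw [smear_apply, ← A.integral_comp_comm (V.integrable_smul_apply hφ ξ)]
  simp only [A.map_smul_of_tower]

lemma commute_smear (hφ : Integrable φ μ) {C : E →L[ℂ] E} (hC : ∀ x, Commute C (V.toFun x)) :
    Commute C (V.smear hφ) := by
  ext ξ
  change C (V.smear hφ ξ) = V.smear hφ (C ξ)
  rw [map_smear_apply, smear_apply]
  simp only [← mul_apply_eq_comp, (hC _).eq]

lemma smear_apply_of_forall_apply_eq (hφ : Integrable φ μ) {ξ : E} (hξ : ∀ x, V.toFun x ξ = ξ) :
    V.smear hφ ξ = (∫ x, φ x ∂μ) • ξ := by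
  simp only [smear_apply, hξ, integral_smul_const]

end Smear

lemma apply_smear {G : Type*} [AddCommGroup G] [TopologicalSpace G] [ContinuousNeg G]
    [SecondCountableTopology G] [MeasurableSpace G] [BorelSpace G] {μ : Measure G}
    (V : UnitaryRep G E) {φ : G → ℝ} (hφ : Integrable φ μ) (y : G) (ξ : E) :
    V.toFun y (V.smear hφ ξ) = (φ ⋆[ContinuousLinearMap.lsmul ℝ ℝ, μ] fun x => V.toFun x ξ) y := by
  rw [map_smear_apply]
  simp only [convolution_lsmul, ← V.add_apply, ← sub_eq_add_neg]

/-- An approximate unit for the representation `V` consisting of operators that regularize vectors.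
Instead of asking that the `R n` lie in the von Neumann algebra generated by `V`, we ask that they
commute with the commutant of `V`. -/
structure IsMollifier {G : Type*} [NormedAddCommGroup G] [NormedSpace ℝ G] (V : UnitaryRep G E)
    (R : ℕ → E →L[ℂ] E) : Prop where
  commute : ∀ n C, (∀ x, Commute C (V.toFun x)) → Commute C (R n)
  contDiff : ∀ n ξ, ContDiff ℝ ∞ fun x => V.toFun x (R n ξ)
  apply_eq : ∀ n ξ, (∀ x, V.toFun x ξ = ξ) → R n ξ = ξ
  tendsto : ∀ ξ, Tendsto (fun n => R n ξ) atTop (𝓝 ξ)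

section Mollifier

variable {G : Type*} [NormedAddCommGroup G] [NormedSpace ℝ G] (V : UnitaryRep G E)

lemma exists_isMollifier [FiniteDimensional ℝ G] : ∃ R, V.IsMollifier R := by
  borelize G
  let μ : Measure G := Measure.addHaar
  let b : ℕ → ContDiffBump (0 : G) := fun n =>
    ⟨1 / ((n : ℝ) + 1) / 2, 1 / ((n : ℝ) + 1), by positivity, half_lt_self (by positivity)⟩
  have hb : Tendsto (fun n => (b n).rOut) atTop (𝓝 0) := tendsto_one_div_add_atTop_nhds_zero_nat
  have hint : ∀ n, Integrable ((b n).normed μ) μ := fun n => (b n).integrable_normed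
  refine ⟨fun n => V.smear (hint n), fun n C hC => V.commute_smear (hint n) hC, fun n ξ => ?_,
    fun n ξ hξ => ?_, fun ξ => ?_⟩
  · simp only [apply_smear]
    exact (b n).hasCompactSupport_normed.contDiff_convolution_left (n := ⊤)
      (ContinuousLinearMap.lsmul ℝ ℝ) (b n).contDiff_normed
      (V.continuous_apply ξ).locallyIntegrable
  · rw [V.smear_apply_of_forall_apply_eq (hint n) hξ, (b n).integral_normed, one_smul]
  · have hconv := ContDiffBump.convolution_tendsto_right_of_continuous (μ := μ) hb
      (V.continuous_apply ξ) 0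
    simpa only [← V.apply_smear (hint _), V.map_zero, one_apply_eq_self] using hconv

variable {V} {R : ℕ → E →L[ℂ] E}

lemma IsMollifier.commute_toFun (hR : V.IsMollifier R) (n : ℕ) (x : G) :
    Commute (R n) (V.toFun x) :=
  (hR.commute n _ fun y => V.commute x y).symm

lemma IsMollifier.mem (hR : V.IsMollifier R) {M : VonNeumannAlgebra E} (hV : ∀ x, V.toFun x ∈ M)
    (n : ℕ) : R n ∈ M := by
  rw [← M.commutant_commutant, VonNeumannAlgebra.mem_commutant_iff]
  intro C hC
  rw [VonNeumannAlgebra.mem_commutant_iff] at hC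
  exact (hR.commute n C fun x => (hC _ (hV x)).symm).eq

end Mollifier

/-! ### Generators in different directions -/

section Along

variable {G : Type*} [AddCommGroup G] [Module ℝ G] [TopologicalSpace G] [ContinuousSMul ℝ G]
  {V : UnitaryRep G E} {a b : G} {ξ x y : E}

lemma mem_generator_along_smul (c : ℝ) (h : (ξ, x) ∈ (V.along a).generator.graph) :
    (ξ, (c : ℂ) • x) ∈ (V.along (c • a)).generator.graph := by
  rw [mem_generator_graph_iff] at h ⊢
  have hcomp := HasDerivAt.scomp (0 : ℝ) (by simpa using h) ((hasDerivAt_id (0 : ℝ)).mul_const c)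
  simpa [Function.comp_def, along, mul_smul, smul_comm Complex.I] using hcomp

lemma mem_generator_along_add (ha : (ξ, x) ∈ (V.along a).generator.graph)
    (hb : (ξ, y) ∈ (V.along b).generator.graph) :
    (ξ, x + y) ∈ (V.along (a + b)).generator.graph := by
  simp only [mem_generator_graph_iff, hasDerivAt_iff_tendsto_slope_zero, zero_add,
    UnitaryRep.map_zero, one_apply_eq_self] at ha hb ⊢
  have hzero : Tendsto (fun t : ℝ => t • a) (𝓝[≠] 0) (𝓝 0) :=
    Tendsto.mono_left (Continuous.tendsto' (by fun_prop) 0 0 (zero_smul ℝ a)) nhdsWithin_le_nhds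
  have hslope : Tendsto (fun t : ℝ => V.toFun (t • a) (t⁻¹ • ((V.along b).toFun t ξ - ξ)))
      (𝓝[≠] 0) (𝓝 (Complex.I • y)) := by
    simpa [Function.comp_def, V.map_zero] using
      (V.continuous_uncurry.tendsto (0, Complex.I • y)).comp (hzero.prodMk_nhds hb)
  rw [smul_add]
  refine (ha.add hslope).congr fun t => ?_
  simp only [along, smul_add, V.add_apply, ContinuousLinearMap.map_smul_of_tower,
    ContinuousLinearMap.map_sub]
  rw [← smul_add, add_comm, sub_add_sub_cancel]

lemma mem_generator_along_sum {ι : Type*} (S : Finset ι) {a : ι → G} {x : ι → E}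
    (h : ∀ i ∈ S, (ξ, x i) ∈ (V.along (a i)).generator.graph) :
    (ξ, ∑ i ∈ S, x i) ∈ (V.along (∑ i ∈ S, a i)).generator.graph := by
  classical
  induction S using Finset.induction_on with
  | empty =>
    rw [mem_generator_graph_iff]
    simpa [along] using hasDerivAt_const (0 : ℝ) (V.toFun 0 ξ)
  | insert i S hi ih =>
    rw [Finset.sum_insert hi, Finset.sum_insert hi]
    exact mem_generator_along_add (h i (Finset.mem_insert_self i S))
      (ih fun j hj => h j (Finset.mem_insert_of_mem hj))

end Along

lemma closure_eq_generator_along {G : Type*} [NormedAddCommGroup G] [NormedSpace ℝ G]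
    [FiniteDimensional ℝ G] {V : UnitaryRep G E} {a : G} {T : E →ₗ.[ℂ] E}
    (hle : T ≤ (V.along a).generator)
    (hdom : ∀ ξ, (ContDiff ℝ ∞ fun x => V.toFun x ξ) → ξ ∈ T.domain) :
    T.closure = (V.along a).generator := by
  have hclosed := (V.along a).isClosed_generator
  refine LinearPMap.eq_of_eq_graph ?_
  rw [← (hclosed.isClosable.leIsClosable hle).graph_closure_eq_closure_graph]
  refine le_antisymm
    (Submodule.topologicalClosure_minimal _ (LinearPMap.le_graph_of_le hle) hclosed) ?_
  obtain ⟨R, hR⟩ := V.exists_isMollifier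
  rintro ⟨ξ, x⟩ hx
  refine mem_closure_of_tendsto ((hR.tendsto ξ).prodMk_nhds (hR.tendsto x))
    (Eventually.of_forall fun n => ?_)
  have hRx : (R n ξ, R n x) ∈ (V.along a).generator.graph :=
    map_mem_generator_graph (fun t => hR.commute_toFun n (t • a)) hx
  obtain ⟨y, hy⟩ := LinearPMap.mem_domain_iff.1 (hdom _ (hR.contDiff n ξ))
  rw [LinearPMap.mem_graph_snd_inj _ hRx (LinearPMap.le_graph_of_le hle hy) rfl]
  exact hy

section MovingHamiltonian

variable {s : ℕ}

lemma prod_eq_smul_add_sum_smul_single (t : ℝ) (v : EuclideanSpace ℝ (Fin s)) :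
    ((t, v) : ℝ × EuclideanSpace ℝ (Fin s)) = t • ((1 : ℝ), (0 : EuclideanSpace ℝ (Fin s)))
      + ∑ j, v j • ((0 : ℝ), EuclideanSpace.single j (1 : ℝ)) := by
  have hv : ∑ j, v j • EuclideanSpace.single j (1 : ℝ) = v := by
    simpa using (EuclideanSpace.basisFun (Fin s) ℝ).sum_repr v
  ext1
  · simp [Prod.fst_sum]
  · simp [Prod.snd_sum, hv]

/-- The operator `γ (H + v P)` on the intersection of the domains of `H` and the `P j`, of which
`movingHamiltonian` is the closure. -/
noncomputable def preMovingHamiltonian (V : UnitaryRep (ℝ × EuclideanSpace ℝ (Fin s)) E)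
    (v : EuclideanSpace ℝ (Fin s)) : E →ₗ.[ℂ] E :=
  (lorentzFactor v : ℂ) • (V.hamiltonian + ∑ j, (v j : ℂ) • V.momentum j)

variable {V : UnitaryRep (ℝ × EuclideanSpace ℝ (Fin s)) E} {v : EuclideanSpace ℝ (Fin s)} {ξ x : E}

lemma mem_preMovingHamiltonian_graph_iff :
    (ξ, x) ∈ (V.preMovingHamiltonian v).graph ↔ ∃ (y : E) (z : Fin s → E),
      (ξ, y) ∈ V.hamiltonian.graph ∧ (∀ j, (ξ, z j) ∈ (V.momentum j).graph) ∧
      (lorentzFactor v : ℂ) • (y + ∑ j, (v j : ℂ) • z j) = x := by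
  simp only [preMovingHamiltonian, mem_graph_smul_iff, mem_graph_add_iff, mem_graph_sum_iff,
    Finset.mem_univ, true_imp_iff]
  constructor
  · rintro ⟨_, ⟨y, _, hy, ⟨w, hw, rfl⟩, rfl⟩, h⟩
    choose z hz hzw using hw
    exact ⟨y, z, hy, hz, by simpa only [hzw] using h⟩
  · rintro ⟨y, z, hy, hz, h⟩
    exact ⟨_, ⟨y, _, hy, ⟨_, fun j => ⟨z j, hz j, rfl⟩, rfl⟩, rfl⟩, h⟩

lemma mem_generator_along_prod {t : ℝ} {y : E} {z : Fin s → E}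
    (hy : (ξ, y) ∈ V.hamiltonian.graph) (hz : ∀ j, (ξ, z j) ∈ (V.momentum j).graph) :
    (ξ, (t : ℂ) • y + ∑ j, (v j : ℂ) • z j) ∈ (V.along (t, v)).generator.graph := by
  rw [prod_eq_smul_add_sum_smul_single]
  exact mem_generator_along_add (mem_generator_along_smul t hy)
    (mem_generator_along_sum _ fun j _ => mem_generator_along_smul (v j) (hz j))

variable (V v) in
lemma preMovingHamiltonian_le :
    V.preMovingHamiltonian v ≤ (V.along (fourVelocity v)).generator := by
  rw [← LinearPMap.le_graph_iff]
  rintro ⟨ξ, x⟩ hx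
  obtain ⟨y, z, hy, hz, rfl⟩ := mem_preMovingHamiltonian_graph_iff.1 hx
  have hmem := mem_generator_along_prod (t := 1) (v := v) hy hz
  rw [Complex.ofReal_one, one_smul] at hmem
  exact mem_generator_along_smul (lorentzFactor v) hmem

variable (V v) in
lemma movingHamiltonian_eq_generator_along :
    V.movingHamiltonian v = (V.along (fourVelocity v)).generator := by
  refine closure_eq_generator_along (V.preMovingHamiltonian_le v) fun ξ hξ => ?_
  have hdom : ∀ a, ∃ y, (ξ, y) ∈ (V.along a).generator.graph := fun a => by
    have hdiff : Differentiable ℝ fun t : ℝ => V.toFun (t • a) ξ :=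
      (hξ.differentiable (by simp)).comp (by fun_prop)
    exact LinearPMap.mem_domain_iff.1 (hdiff 0)
  obtain ⟨y, hy⟩ := hdom (1, 0)
  choose z hz using fun j : Fin s => hdom (0, EuclideanSpace.single j 1)
  exact LinearPMap.mem_domain_iff.2 ⟨_, mem_preMovingHamiltonian_graph_iff.2 ⟨y, z, hy, hz, rfl⟩⟩

lemma apply_eq_of_mem_graph {Ω : E} (hH : (Ω, (0 : E)) ∈ V.hamiltonian.graph)
    (hP : ∀ j, (Ω, (0 : E)) ∈ (V.momentum j).graph) (x : ℝ × EuclideanSpace ℝ (Fin s)) :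
    V.toFun x Ω = Ω := by
  have hmem := mem_generator_along_prod (t := x.1) (v := x.2) hH hP
  simp only [smul_zero, Finset.sum_const_zero, add_zero] at hmem
  simpa [along] using apply_eq_of_mem_generator_graph hmem 1

end MovingHamiltonian

end UnitaryRep

/-! ### Cycles in the interaction picture -/

section Evolution

variable {A : Type*} [NormedRing A] [NormedAlgebra ℂ A]

/-- The evolution `exp (-i r b)` generated by the constant Hamiltonian `b`. -/
noncomputable def evolution (b : A) (r : ℝ) : A :=
  NormedSpace.exp (r • (-Complex.I • b))

@[simp]
lemma evolution_zero (b : A) : evolution b 0 = 1 := by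
  rw [evolution, zero_smul, NormedSpace.exp_zero]

lemma hasDerivAt_evolution [CompleteSpace A] (b : A) (r : ℝ) :
    HasDerivAt (evolution b) ((-Complex.I • b) * evolution b r) r :=
  hasDerivAt_exp_smul_const' (𝕂 := ℝ) (-Complex.I • b) r

lemma commute_evolution (b : A) (r : ℝ) : Commute b (evolution b r) :=
  (((Commute.refl b).smul_right (-Complex.I)).smul_right r).exp_right

lemma evolution_mem_unitary [CompleteSpace A] [StarRing A] [ContinuousStar A] [StarModule ℂ A]
    {b : A} (hb : IsSelfAdjoint b) (r : ℝ) : evolution b r ∈ unitary A := by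
  let +nondep : NormedAlgebra ℚ A := NormedAlgebra.restrictScalars ℚ ℂ A
  refine NormedSpace.exp_mem_unitary_of_mem_skewAdjoint (skewAdjoint.smul_mem r ?_)
  rw [skewAdjoint.mem_iff, star_smul, hb.star_eq]
  simp

end Evolution

lemma hasDerivAt_evolution_apply (B : E →L[ℂ] E) (ξ : E) (r : ℝ) :
    HasDerivAt (fun r => evolution B r ξ) (-Complex.I • B (evolution B r ξ)) r :=
  hasDerivAt_clm_apply (hasDerivAt_evolution B r) ξ

section Heisenberg

/-- The Heisenberg evolution `U(-t) B U(t)` of the operator `B`. For `U(t) = exp (itK)` it runs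
backwards in time, so as to cancel the conjugation by `U(t)` in the interaction picture. -/
noncomputable def heisenberg (U : UnitaryRep ℝ E) (B : E →L[ℂ] E) (t : ℝ) : E →L[ℂ] E :=
  U.toFun (-t) * B * U.toFun t

variable {U : UnitaryRep ℝ E} {B δ : E →L[ℂ] E} {M : VonNeumannAlgebra E}

lemma heisenberg_apply (t : ℝ) (ξ : E) :
    heisenberg U B t ξ = U.toFun (-t) (B (U.toFun t ξ)) := rfl

lemma heisenberg_mem (hU : ∀ t, U.toFun t ∈ M) (hB : B ∈ M) (t : ℝ) : heisenberg U B t ∈ M :=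
  mul_mem (mul_mem (hU (-t)) hB) (hU t)

lemma star_heisenberg (t : ℝ) : star (heisenberg U B t) = heisenberg U (star B) t := by
  simp only [heisenberg, star_mul, U.star_toFun, neg_neg, mul_assoc]

lemma isSelfAdjoint_heisenberg (hB : IsSelfAdjoint B) (t : ℝ) :
    IsSelfAdjoint (heisenberg U B t) := by
  rw [isSelfAdjoint_iff, star_heisenberg, hB.star_eq]

lemma inner_apply_neg_heisenberg (t : ℝ) (ξ η : E) :
    ⟪U.toFun (-t) ξ, heisenberg U B t (U.toFun (-t) η)⟫ = ⟪ξ, B η⟫ := by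
  rw [heisenberg_apply, U.apply_neg_apply, U.inner_apply_apply]

lemma hasDerivAt_heisenberg (h : HasDerivAt (heisenberg U B) δ 0) (t : ℝ) :
    HasDerivAt (heisenberg U B) (heisenberg U δ t) t := by
  have hshift : HasDerivAt (fun r => heisenberg U B (r - t)) δ t :=
    HasDerivAt.comp_sub_const t t (by rwa [sub_self])
  refine ((hshift.const_mul (U.toFun (-t))).mul_const (U.toFun t)).congr_of_eventuallyEq
    (Eventually.of_forall fun r => ?_)
  ext ξ
  simp only [heisenberg, mul_apply_eq_comp, ← U.add_apply, sub_add_cancel]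
  rw [neg_sub, sub_eq_add_neg, neg_add_cancel_left]

lemma isSelfAdjoint_of_hasDerivAt_heisenberg (hB : IsSelfAdjoint B) {t : ℝ}
    (h : HasDerivAt (heisenberg U B) δ t) : IsSelfAdjoint δ :=
  (h.star.congr_of_eventuallyEq (Eventually.of_forall fun r =>
    (isSelfAdjoint_heisenberg hB r).star_eq.symm)).unique h

end Heisenberg

/-- The function `φ` moves from `φ 0 = 0` to its final value during the time interval
`[0, T]`, smoothly enough for `switchedCycle` to be a cycle. Its derivative is required to
vanish at the end points, so that the cycle is switched on and off continuously. -/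
structure IsSwitching (T : ℝ) (φ : ℝ → ℝ) : Prop where
  contDiff : ContDiff ℝ 2 φ
  zero : φ 0 = 0
  deriv_eq_zero : ∀ t, t ∉ Set.Ioo 0 T → deriv φ t = 0

section Switching

variable {T : ℝ} {φ : ℝ → ℝ}

lemma IsSwitching.contDiff_deriv (hφ : IsSwitching T φ) : ContDiff ℝ 1 (deriv φ) :=
  ((contDiff_succ_iff_deriv (n := 1)).1 hφ.contDiff).2.2

lemma IsSwitching.hasDerivAt (hφ : IsSwitching T φ) (t : ℝ) : HasDerivAt φ (deriv φ t) t :=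
  (hφ.contDiff.differentiable two_ne_zero t).hasDerivAt

lemma IsSwitching.hasDerivAt_deriv (hφ : IsSwitching T φ) (t : ℝ) :
    HasDerivAt (deriv φ) (deriv (deriv φ) t) t :=
  (hφ.contDiff_deriv.differentiable one_ne_zero t).hasDerivAt

lemma IsSwitching.integral_deriv_deriv (hφ : IsSwitching T φ) :
    ∫ t in (0 : ℝ)..T, deriv (deriv φ) t = 0 := by
  rw [intervalIntegral.integral_eq_sub_of_hasDerivAt (fun t _ => hφ.hasDerivAt_deriv t)
    ((hφ.contDiff_deriv.continuous_deriv le_rfl).intervalIntegrable 0 T),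
    hφ.deriv_eq_zero T (by simp), hφ.deriv_eq_zero 0 (by simp), sub_zero]

lemma isSwitching_mul_smoothTransition (c : ℝ) :
    IsSwitching 1 fun t => c * Real.smoothTransition t where
  contDiff := contDiff_const.mul Real.smoothTransition.contDiff
  zero := by simp [Real.smoothTransition.zero]
  deriv_eq_zero t ht := by
    have hzero : deriv Real.smoothTransition t = 0 := by
      rw [Set.mem_Ioo, not_and_or, not_lt, not_lt] at ht
      rcases ht with ht | ht
      · refine IsLocalMin.deriv_eq_zero (Eventually.of_forall fun r => ?_)
        rw [Real.smoothTransition.zero_of_nonpos ht]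
        exact Real.smoothTransition.nonneg r
      · refine IsLocalMax.deriv_eq_zero (Eventually.of_forall fun r => ?_)
        rw [Real.smoothTransition.one_of_one_le ht]
        exact Real.smoothTransition.le_one r
    rw [deriv_const_mul_field, hzero, mul_zero]

end Switching

section SwitchedCycle

/-- The cycle `t ↦ φ'(t) U(-t) B U(t)`. In the interaction picture its perturbation is `φ'(t) B`,
so that the perturbed evolution is `exp (-i φ(t) B)`. -/
noncomputable def switchedCycle (U : UnitaryRep ℝ E) (B : E →L[ℂ] E) (φ : ℝ → ℝ) (t : ℝ) :
    E →L[ℂ] E :=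
  deriv φ t • heisenberg U B t

variable {U : UnitaryRep ℝ E} {B δ : E →L[ℂ] E} {M : VonNeumannAlgebra E} {T : ℝ} {φ : ℝ → ℝ}

lemma isCycle_switchedCycle (hU : ∀ t, U.toFun t ∈ M) (hBM : B ∈ M) (hB : IsSelfAdjoint B)
    (hC : ContDiff ℝ 1 (heisenberg U B)) (hφ : IsSwitching T φ) :
    IsCycle M T (switchedCycle U B φ) where
  mem t := by
    rw [switchedCycle, ← Complex.coe_smul]
    exact M.toStarSubalgebra.smul_mem (heisenberg_mem hU hBM t) _
  selfAdjoint t := (IsSelfAdjoint.all (deriv φ t)).smul (isSelfAdjoint_heisenberg hB t)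
  contDiff := hφ.contDiff_deriv.smul hC
  eq_zero t ht := by
    rw [switchedCycle, hφ.deriv_eq_zero t fun h => ht (Set.Ioo_subset_Icc_self h), zero_smul]

lemma isPerturbedEvolution_switchedCycle (hB : IsSelfAdjoint B) (hφ : IsSwitching T φ) :
    IsPerturbedEvolution U (switchedCycle U B φ) fun t => evolution B (φ t) where
  mem_unitary t _ := evolution_mem_unitary hB (φ t)
  initial := by rw [hφ.zero, evolution_zero]
  hasDeriv ξ t _ := by
    refine ((hasDerivAt_evolution_apply B ξ (φ t)).scomp t
      (hφ.hasDerivAt t)).hasDerivWithinAt.congr_deriv ?_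
    rw [switchedCycle, smul_apply, heisenberg_apply, U.apply_neg_apply,
      ContinuousLinearMap.map_smul_of_tower, U.apply_neg_apply, smul_comm]

lemma inner_deriv_switchedCycle (hB : IsSelfAdjoint B) (h : HasDerivAt (heisenberg U B) δ 0)
    (hφ : IsSwitching T φ) (Ω : E) (t : ℝ) :
    (⟪U.toFun (-t) (evolution B (φ t) Ω),
        deriv (switchedCycle U B φ) t (U.toFun (-t) (evolution B (φ t) Ω))⟫).re =
      (⟪evolution B (φ t) Ω, δ (evolution B (φ t) Ω)⟫).re * deriv φ t +
        (⟪Ω, B Ω⟫).re * deriv (deriv φ) t := by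
  have hderiv : deriv (switchedCycle U B φ) t =
      deriv φ t • heisenberg U δ t + deriv (deriv φ) t • heisenberg U B t :=
    ((hφ.hasDerivAt_deriv t).smul (hasDerivAt_heisenberg h t)).deriv
  have hconserved : ⟪evolution B (φ t) Ω, B (evolution B (φ t) Ω)⟫ = ⟪Ω, B Ω⟫ := by
    rw [← mul_apply_eq_comp, (commute_evolution B (φ t)).eq, mul_apply_eq_comp,
      ContinuousLinearMap.inner_map_map_of_mem_unitary (evolution_mem_unitary hB (φ t))]
  rw [hderiv, add_apply, smul_apply, smul_apply, inner_add_right, ← Complex.coe_smul,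
    ← Complex.coe_smul, inner_smul_right, inner_smul_right, inner_apply_neg_heisenberg,
    inner_apply_neg_heisenberg, hconserved, Complex.add_re, Complex.re_ofReal_mul,
    Complex.re_ofReal_mul, mul_comm (deriv φ t), mul_comm (deriv (deriv φ) t)]

lemma continuous_re_inner_evolution (B δ : E →L[ℂ] E) (Ω : E) :
    Continuous fun r => (⟪evolution B r Ω, δ (evolution B r Ω)⟫).re := by
  have hcont : Continuous fun r => evolution B r Ω :=
    continuous_iff_continuousAt.2 fun r => (hasDerivAt_evolution_apply B Ω r).continuousAt
  exact Complex.continuous_re.comp (hcont.inner (δ.continuous.comp hcont))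

lemma work_switchedCycle (hB : IsSelfAdjoint B) (h : HasDerivAt (heisenberg U B) δ 0)
    (hφ : IsSwitching T φ) (Ω : E) :
    work U Ω T (switchedCycle U B φ) (fun t => evolution B (φ t)) =
      ∫ r in (0 : ℝ)..φ T, (⟪evolution B r Ω, δ (evolution B r Ω)⟫).re := by
  have hg := continuous_re_inner_evolution B δ Ω
  have hφ'' : Continuous (deriv (deriv φ)) := hφ.contDiff_deriv.continuous_deriv le_rfl
  have hsubst := intervalIntegral.integral_comp_mul_deriv (a := 0) (b := T)
    (fun t _ => hφ.hasDerivAt t) hφ.contDiff_deriv.continuous.continuousOn hg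
  have hint : Continuous fun t => (⟪evolution B (φ t) Ω, δ (evolution B (φ t) Ω)⟫).re * deriv φ t :=
    (hg.comp hφ.contDiff.continuous).mul hφ.contDiff_deriv.continuous
  simp only [work, inner_deriv_switchedCycle hB h hφ]
  rw [intervalIntegral.integral_add (hint.intervalIntegrable 0 T)
    ((hφ''.intervalIntegrable 0 T).const_mul _), intervalIntegral.integral_const_mul,
    hφ.integral_deriv_deriv, mul_zero, add_zero]
  rwa [hφ.zero] at hsubst

end SwitchedCycle

/-! ### Passivity -/

section Passive

variable {U : UnitaryRep ℝ E} {M : VonNeumannAlgebra E} {Ω ξ x : E} {A B C Q R δ : E →L[ℂ] E}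

lemma IsPassive.integral_nonneg (hpass : IsPassive M Ω U.generator) (hU : ∀ t, U.toFun t ∈ M)
    (hBM : B ∈ M) (hB : IsSelfAdjoint B) (hC : ContDiff ℝ 1 (heisenberg U B))
    (h : HasDerivAt (heisenberg U B) δ 0) (c : ℝ) :
    0 ≤ ∫ r in (0 : ℝ)..c, (⟪evolution B r Ω, δ (evolution B r Ω)⟫).re := by
  have hφ := isSwitching_mul_smoothTransition c
  have hwork := hpass U rfl 1 _ _ one_pos (isCycle_switchedCycle hU hBM hB hC hφ)
    (isPerturbedEvolution_switchedCycle hB hφ)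
  rwa [neg_nonpos, work_switchedCycle hB h hφ, Real.smoothTransition.one, mul_one] at hwork

lemma hasDerivAt_re_inner_evolution (hδ : IsSelfAdjoint δ) (B : E →L[ℂ] E) (Ω : E) :
    HasDerivAt (fun r => (⟪evolution B r Ω, δ (evolution B r Ω)⟫).re)
      (-2 * (⟪B Ω, δ Ω⟫).im) 0 := by
  have hexp := hasDerivAt_evolution_apply B Ω 0
  refine (hasDerivAt_clm_comp Complex.reCLM
    (hexp.inner ℂ (hasDerivAt_clm_comp δ hexp))).congr_deriv ?_
  have hsymm : (⟪Ω, δ (B Ω)⟫).im = -(⟪B Ω, δ Ω⟫).im := by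
    rw [← ContinuousLinearMap.adjoint_inner_left, ← ContinuousLinearMap.star_eq_adjoint,
      hδ.star_eq, ← inner_conj_symm, Complex.conj_im]
  simp only [evolution_zero, one_apply_eq_self, neg_smul, map_neg, map_smul, inner_neg_right,
    inner_smul_right, inner_neg_left, inner_smul_left, Complex.conj_I, neg_mul, neg_neg,
    Complex.reCLM_apply, Complex.add_re, Complex.neg_re, Complex.mul_re, Complex.I_re, zero_mul,
    Complex.I_im, hsymm, mul_neg, one_mul, sub_neg_eq_add, zero_add, zero_sub]
  ring

lemma IsPassive.im_inner_nonpos (hpass : IsPassive M Ω U.generator) (hU : ∀ t, U.toFun t ∈ M)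
    (hBM : B ∈ M) (hB : IsSelfAdjoint B) (hC : ContDiff ℝ 1 (heisenberg U B))
    (h : HasDerivAt (heisenberg U B) δ 0) : (⟪B Ω, δ Ω⟫).im ≤ 0 := by
  have hresponse := nonneg_of_forall_integral_nonneg (continuous_re_inner_evolution B δ Ω)
    (hasDerivAt_re_inner_evolution (isSelfAdjoint_of_hasDerivAt_heisenberg hB h) B Ω)
    (hpass.integral_nonneg hU hBM hB hC h)
  linarith

lemma hasDerivAt_heisenberg_apply (hΩ : ∀ t, U.toFun t Ω = Ω)
    (h : (B Ω, x) ∈ U.generator.graph) :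
    HasDerivAt (fun t => heisenberg U B t Ω) (-(Complex.I • x)) 0 := by
  have hneg : HasDerivAt (fun t => U.toFun (-t) (B Ω)) (-(Complex.I • x)) 0 := by
    simpa [Function.comp_def, U.map_zero] using
      (UnitaryRep.hasDerivAt_apply h (-0)).scomp (0 : ℝ) (hasDerivAt_neg 0)
  simpa only [heisenberg_apply, hΩ] using hneg

-- Perturb by `B = A + A*`: since `A* Ω = 0`, it satisfies `B Ω = A Ω`.
lemma IsPassive.re_inner_nonneg_of_star_apply_eq_zero (hpass : IsPassive M Ω U.generator)
    (hU : ∀ t, U.toFun t ∈ M) (hΩ : ∀ t, U.toFun t Ω = Ω) (hA : A ∈ M) (hAΩ : star A Ω = 0)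
    (hC : ContDiff ℝ 1 (heisenberg U A)) (h : (A Ω, x) ∈ U.generator.graph) :
    0 ≤ (⟪A Ω, x⟫).re := by
  have hheis : heisenberg U (A + star A) = fun t => heisenberg U A t + star (heisenberg U A t) := by
    funext t
    rw [star_heisenberg]
    simp only [heisenberg, mul_add, add_mul]
  have hCB : ContDiff ℝ 1 (heisenberg U (A + star A)) := by
    rw [hheis]
    exact hC.add ((starL' ℝ (A := E →L[ℂ] E)).contDiff.comp hC)
  have hBΩ : (A + star A) Ω = A Ω := by rw [add_apply, hAΩ, add_zero]
  have hderiv := (hCB.differentiable one_ne_zero 0).hasDerivAt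
  have hδΩ : deriv (heisenberg U (A + star A)) 0 Ω = -(Complex.I • x) :=
    (hasDerivAt_clm_apply hderiv Ω).unique (hasDerivAt_heisenberg_apply hΩ (by rwa [hBΩ]))
  have hresponse := hpass.im_inner_nonpos hU (add_mem hA (star_mem hA))
    (IsSelfAdjoint.add_star_self A) hCB hderiv
  simpa [hBΩ, hδΩ, inner_smul_right] using hresponse

lemma contDiff_heisenberg_mul (hQ : ∀ t, Commute Q (U.toFun t)) (hR : ∀ t, Commute R (U.toFun t))
    (hC : ContDiff ℝ 1 fun t => U.toFun t * R) (C : E →L[ℂ] E) :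
    ContDiff ℝ 1 (heisenberg U (Q * R * C * R)) := by
  have hheis : heisenberg U (Q * R * C * R) =
      fun t => Q * (U.toFun (-t) * R) * C * (U.toFun t * R) := by
    funext t
    rw [heisenberg, mul_assoc, mul_assoc (Q * R * C), (hR t).eq]
    simp only [← mul_assoc, (hQ (-t)).eq]
  rw [hheis]
  exact ((contDiff_const.mul (hC.comp contDiff_neg)).mul contDiff_const).mul hC

lemma IsPassive.re_inner_apply_nonneg_of_mem (hpass : IsPassive M Ω U.generator)
    (hU : ∀ t, U.toFun t ∈ M) (hΩ : ∀ t, U.toFun t Ω = Ω)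
    (hQM : Q ∈ M) (hQ : ∀ t, Commute Q (U.toFun t)) (hQΩ : star Q Ω = 0)
    (hRM : R ∈ M) (hR : ∀ t, Commute R (U.toFun t)) (hRΩ : R Ω = Ω)
    (hRC : ContDiff ℝ 1 fun t => U.toFun t * R) (hC : C ∈ M)
    (h : (R (C Ω), x) ∈ U.generator.graph) : 0 ≤ (⟪Q (R (C Ω)), Q x⟫).re := by
  have hAΩ : (Q * R * C * R) Ω = Q (R (C Ω)) := by simp only [mul_apply_eq_comp, hRΩ]
  rw [← hAΩ]
  refine hpass.re_inner_nonneg_of_star_apply_eq_zero hU hΩ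
    (mul_mem (mul_mem (mul_mem hQM hRM) hC) hRM) ?_ (contDiff_heisenberg_mul hQ hR hRC C) ?_
  · simp only [star_mul, mul_apply_eq_comp, hQΩ, ContinuousLinearMap.map_zero]
  · rw [hAΩ]
    exact UnitaryRep.map_mem_generator_graph hQ h

lemma IsPassive.re_inner_apply_apply_nonneg (hpass : IsPassive M Ω U.generator)
    (hcyc : IsCyclic M Ω) (hU : ∀ t, U.toFun t ∈ M) (hΩ : ∀ t, U.toFun t Ω = Ω)
    (hQM : Q ∈ M) (hQ : ∀ t, Commute Q (U.toFun t)) (hQΩ : star Q Ω = 0)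
    (hRM : R ∈ M) (hR : ∀ t, Commute R (U.toFun t)) (hRΩ : R Ω = Ω)
    (hRC : ContDiff ℝ 1 fun t => U.toFun t * R) (h : (R ξ, x) ∈ U.generator.graph) :
    0 ≤ (⟪Q (R ξ), Q x⟫).re := by
  obtain ⟨D, hD⟩ := exists_clm_mem_graph U.isClosed_generator fun ζ =>
    (hasDerivAt_clm_apply (hRC.differentiable one_ne_zero 0).hasDerivAt ζ).differentiableAt
  have hclosed : IsClosed {ζ | 0 ≤ (⟪Q (R ζ), Q (D ζ)⟫).re} :=
    isClosed_le continuous_const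
      (Complex.continuous_re.comp (Continuous.inner (by fun_prop) (by fun_prop)))
  have hcyclic : {ζ | ∃ C ∈ M, C Ω = ζ} ⊆ {ζ | 0 ≤ (⟪Q (R ζ), Q (D ζ)⟫).re} := by
    rintro _ ⟨C, hC, rfl⟩
    exact hpass.re_inner_apply_nonneg_of_mem hU hΩ hQM hQ hQΩ hRM hR hRΩ hRC hC (hD (C Ω))
  rw [LinearPMap.mem_graph_snd_inj _ h (hD ξ) rfl]
  exact hclosed.closure_subset_iff.2 hcyclic (hcyc ξ)

lemma IsPassive.re_inner_apply_nonneg (hpass : IsPassive M Ω U.generator)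
    (hcyc : IsCyclic M Ω) (hU : ∀ t, U.toFun t ∈ M) (hΩ : ∀ t, U.toFun t Ω = Ω)
    (hQM : Q ∈ M) (hQ : ∀ t, Commute Q (U.toFun t)) (hQΩ : star Q Ω = 0)
    (h : (ξ, x) ∈ U.generator.graph) : 0 ≤ (⟪Q ξ, Q x⟫).re := by
  obtain ⟨R, hR⟩ := U.exists_isMollifier
  have hlim : Tendsto (fun n => (⟪Q (R n ξ), Q (R n x)⟫).re) atTop (𝓝 (⟪Q ξ, Q x⟫).re) :=
    (Complex.continuous_re.tendsto _).comp
      (((Q.continuous.tendsto ξ).comp (hR.tendsto ξ)).inner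
        ((Q.continuous.tendsto x).comp (hR.tendsto x)))
  refine ge_of_tendsto' hlim fun n => ?_
  have hRC : ContDiff ℝ 1 fun t => U.toFun t * R n :=
    UnitaryRep.contDiff_one_mul_of_forall_contDiff_two fun ζ =>
      contDiff_infty.1 (hR.contDiff n ζ) 2
  exact hpass.re_inner_apply_apply_nonneg hcyc hU hΩ hQM hQ hQΩ (hR.mem hU n)
    (hR.commute_toFun n) (hR.apply_eq n Ω hΩ) hRC
    (UnitaryRep.map_mem_generator_graph (hR.commute_toFun n) h)

lemma IsPassive.generator_nonneg (hpass : IsPassive M Ω U.generator) (hcyc : IsCyclic M Ω)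
    (hU : ∀ t, U.toFun t ∈ M) (hΩ : ∀ t, U.toFun t Ω = Ω) (h : (ξ, x) ∈ U.generator.graph) :
    0 ≤ (⟪ξ, x⟫).re := by
  refine UnitaryRep.re_inner_nonneg_of_forall_sub_apply h fun t => ?_
  have hQΩ : star (1 - U.toFun t) Ω = 0 := by simp [U.star_toFun, hΩ]
  exact hpass.re_inner_apply_nonneg hcyc hU hΩ (sub_mem (one_mem M) (hU t))
    (fun r => (Commute.one_left _).sub_left (U.commute t r)) hQΩ h

end Passive

/-! ### Spectral measures -/

namespace ProjectionValuedMeasure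

variable {X : Type*} [MeasurableSpace X] {F : ProjectionValuedMeasure X E}

lemma scalarMeasure_apply (ξ : E) {S : Set X} (hS : MeasurableSet S) :
    F.scalarMeasure ξ S = ENNReal.ofReal (⟪ξ, F.proj S ξ⟫).re :=
  Measure.ofMeasurable_apply S hS

instance isFiniteMeasure_scalarMeasure (ξ : E) : IsFiniteMeasure (F.scalarMeasure ξ) :=
  ⟨by rw [scalarMeasure_apply ξ MeasurableSet.univ]; exact ENNReal.ofReal_lt_top⟩

lemma scalarMeasure_real_univ (ξ : E) : (F.scalarMeasure ξ).real Set.univ = ‖ξ‖ ^ 2 := by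
  rw [measureReal_def, scalarMeasure_apply ξ MeasurableSet.univ, F.proj_univ, one_apply_eq_self,
    ← inner_self_eq_norm_sq (𝕜 := ℂ)]
  exact ENNReal.toReal_ofReal (inner_self_nonneg (𝕜 := ℂ) (x := ξ))

lemma ae_mem_of_proj_apply_eq {ξ : E} {S : Set X} (hS : MeasurableSet S) (h : F.proj S ξ = ξ) :
    ∀ᵐ q ∂F.scalarMeasure ξ, q ∈ S := by
  have hzero : F.proj Sᶜ ξ = 0 := by
    rw [← h, ← mul_apply_eq_comp, ← F.proj_inter _ _ hS.compl hS, Set.compl_inter_self,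
      F.proj_empty, zero_apply]
  change F.scalarMeasure ξ Sᶜ = 0
  rw [scalarMeasure_apply ξ hS.compl, hzero, inner_zero_right, Complex.zero_re,
    ENNReal.ofReal_zero]

lemma Represents.integrable {f : X → ℝ} {A : E →ₗ.[ℂ] E} (hA : F.Represents f A) {ξ : E}
    (hf : AEStronglyMeasurable f (F.scalarMeasure ξ)) (hξ : ξ ∈ A.domain) :
    Integrable f (F.scalarMeasure ξ) :=
  ((memLp_two_iff_integrable_sq hf).2 ((hA.1 ξ).1 hξ)).integrable one_le_two

lemma Represents.inner_eq {f : X → ℝ} {A : E →ₗ.[ℂ] E} (hA : F.Represents f A) {ξ x : E}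
    (h : (ξ, x) ∈ A.graph) : ⟪ξ, x⟫ = ((∫ q, f q ∂F.scalarMeasure ξ : ℝ) : ℂ) := by
  obtain ⟨ξ, rfl, rfl⟩ := (LinearPMap.mem_graph_iff A).1 h
  exact hA.2 ξ

variable [TopologicalSpace X] [OpensMeasurableSpace X] {p : X}

lemma exists_ne_zero_ae_mem_of_mem_support (hp : p ∈ F.support) {S : Set X} (hS : S ∈ 𝓝 p) :
    ∃ ξ ≠ 0, ∀ᵐ q ∂F.scalarMeasure ξ, q ∈ S := by
  obtain ⟨O, hOS, hO, hpO⟩ := mem_nhds_iff.1 hS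
  obtain ⟨ζ, hζ⟩ := DFunLike.ne_iff.1 (hp O hO hpO)
  have hproj : F.proj O (F.proj O ζ) = F.proj O ζ :=
    DFunLike.congr_fun (F.isStarProjection O hO.measurableSet).isIdempotentElem.eq ζ
  exact ⟨F.proj O ζ, hζ, (ae_mem_of_proj_apply_eq hO.measurableSet hproj).mono fun _ h => hOS h⟩

lemma exists_forall_integrable_and_integral_neg [WeaklyLocallyCompactSpace X] (hp : p ∈ F.support)
    {l : X → ℝ} (hl : Continuous l) (hlp : l p < 0) :
    ∃ ξ, (∀ g : X → ℝ, Continuous g → Integrable g (F.scalarMeasure ξ)) ∧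
      ∫ q, l q ∂F.scalarMeasure ξ < 0 := by
  obtain ⟨K, hK, hKp⟩ := exists_compact_mem_nhds p
  have hnhds : K ∩ {q | l q < l p / 2} ∈ 𝓝 p :=
    inter_mem hKp (hl.continuousAt.eventually_lt_const (by linarith))
  obtain ⟨ξ, hξ, hae⟩ := exists_ne_zero_ae_mem_of_mem_support hp hnhds
  have hint : ∀ g : X → ℝ, Continuous g → Integrable g (F.scalarMeasure ξ) := fun g hg => by
    obtain ⟨C, hC⟩ := hK.exists_bound_of_continuousOn hg.continuousOn
    exact Integrable.of_bound hg.aestronglyMeasurable C (hae.mono fun q hq => hC q hq.1)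
  refine ⟨ξ, hint, ?_⟩
  calc ∫ q, l q ∂F.scalarMeasure ξ ≤ ∫ _, l p / 2 ∂F.scalarMeasure ξ :=
        integral_mono_ae (hint l hl) (integrable_const _) (hae.mono fun q hq => hq.2.le)
    _ = ‖ξ‖ ^ 2 * (l p / 2) := by
        rw [integral_const, scalarMeasure_real_univ, smul_eq_mul]
    _ < 0 := mul_neg_of_pos_of_neg (pow_pos (norm_pos_iff.2 hξ) 2) (by linarith)

end ProjectionValuedMeasure

section JointSpectrum

variable {s : ℕ} {H : E →ₗ.[ℂ] E} {P : Fin s → E →ₗ.[ℂ] E}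
  {F : ProjectionValuedMeasure (ℝ × EuclideanSpace ℝ (Fin s)) E}

lemma IsJointSpectralMeasure.inner_smul_add_sum_smul_eq (hF : IsJointSpectralMeasure H P F)
    {ξ y : E} {z : Fin s → E} (hy : (ξ, y) ∈ H.graph) (hz : ∀ j, (ξ, z j) ∈ (P j).graph) (t : ℝ)
    (v : EuclideanSpace ℝ (Fin s)) :
    ⟪ξ, (t : ℂ) • y + ∑ j, (v j : ℂ) • z j⟫ =
      ((∫ q, (t * q.1 + inner ℝ v q.2) ∂F.scalarMeasure ξ : ℝ) : ℂ) := by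
  have hH : Integrable (fun q => q.1) (F.scalarMeasure ξ) :=
    hF.energy.integrable continuous_fst.aestronglyMeasurable (LinearPMap.mem_domain_of_mem_graph hy)
  have hP : ∀ j, Integrable (fun q => q.2 j) (F.scalarMeasure ξ) := fun j =>
    (hF.momentum j).integrable (Continuous.aestronglyMeasurable (by fun_prop))
      (LinearPMap.mem_domain_of_mem_graph (hz j))
  have hinner : ∀ k : EuclideanSpace ℝ (Fin s), inner ℝ v k = ∑ j, v j * k j := fun k => by
    simp [PiLp.inner_apply, mul_comm]
  simp only [hinner]
  rw [integral_add (hH.const_mul t) (integrable_finsetSum _ fun j _ => (hP j).const_mul (v j)),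
    integral_finsetSum _ fun j _ => (hP j).const_mul (v j)]
  simp [integral_const_mul, hF.energy.inner_eq hy, fun j => (hF.momentum j).inner_eq (hz j)]

lemma IsJointSpectralMeasure.exists_mem_generator_graph_re_inner_neg
    {V : UnitaryRep (ℝ × EuclideanSpace ℝ (Fin s)) E}
    (hF : IsJointSpectralMeasure V.hamiltonian V.momentum F)
    {p a : ℝ × EuclideanSpace ℝ (Fin s)} (hp : p ∈ F.support)
    (hneg : a.1 * p.1 + inner ℝ a.2 p.2 < 0) :
    ∃ ξ x, (ξ, x) ∈ (V.along a).generator.graph ∧ (⟪ξ, x⟫).re < 0 := by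
  obtain ⟨ξ, hint, hlt⟩ := ProjectionValuedMeasure.exists_forall_integrable_and_integral_neg hp
    (l := fun q => a.1 * q.1 + inner ℝ a.2 q.2) (by fun_prop) hneg
  obtain ⟨y, hy⟩ := LinearPMap.mem_domain_iff.1 ((hF.energy.1 ξ).2 (hint _ (by fun_prop)))
  choose z hz using fun j =>
    LinearPMap.mem_domain_iff.1 (((hF.momentum j).1 ξ).2 (hint _ (by fun_prop)))
  refine ⟨ξ, _, UnitaryRep.mem_generator_along_prod hy hz, ?_⟩
  rwa [hF.inner_smul_add_sum_smul_eq hy hz, Complex.ofReal_re]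

end JointSpectrum

end Passivity

theorem proposition3 {E : Type*} [NormedAddCommGroup E] [InnerProductSpace ℂ E] [CompleteSpace E]
    (s : ℕ) (M : VonNeumannAlgebra E)
    (Ω : E) (hΩ : ‖Ω‖ = 1) (hcyc : IsCyclic M Ω)
    (V : UnitaryRep (ℝ × EuclideanSpace ℝ (Fin s)) E)
    (hH : (Ω, (0 : E)) ∈ V.hamiltonian.graph)
    (hP : ∀ j, (Ω, (0 : E)) ∈ (V.momentum j).graph)
    (hpassive : ∀ v : EuclideanSpace ℝ (Fin s), ‖v‖ < 1 → IsPassive M Ω (V.movingHamiltonian v))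
    (hVM : ∀ x, V.toFun x ∈ M) :
    jointSpectrum V.hamiltonian V.momentum ⊆ forwardCone s := by
  rintro p ⟨F, hF, hp⟩
  by_contra hcone
  rw [mem_forwardCone_iff, not_le] at hcone
  obtain ⟨v, hv, hneg⟩ := exists_fourVelocity_pairing_neg hcone
  obtain ⟨ξ, x, hx, hlt⟩ := hF.exists_mem_generator_graph_re_inner_neg hp hneg
  have hpass : IsPassive M Ω (V.along (fourVelocity v)).generator := by
    rw [← V.movingHamiltonian_eq_generator_along v]
    exact hpassive v hv
  have hinv : ∀ t, (V.along (fourVelocity v)).toFun t Ω = Ω := fun t =>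
    UnitaryRep.apply_eq_of_mem_graph hH hP (t • fourVelocity v)
  exact (hpass.generator_nonneg hcyc (fun t => hVM (t • fourVelocity v)) hinv hx).not_gt hlt
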